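/- Let $n\in\mathbb N$, let $F$ be a continuous real function of $(s,p,X)\in\mathbb R\times\mathbb R^n\times\mathbb R^{n\times n}$, and let $u:\mathbb R^n\to\mathbb R$ be an entire solution of $F(u,\nabla u,\nabla^2u)=0$ such that $u\in C^2(\mathbb R^n)\cap L^\infty(\mathbb R^n)$, $\nabla u\in C^\alpha(\mathbb R^n;\mathbb R^n)$ (globally Hölder) for some $\alpha\in(0,1)$, and $|\nabla u|\le C$ on $\mathbb R^n$ for some constant $C>0$. Let $B\in C([0,\infty))\cap C^2((0,\infty))$ with $B(0)=0$, $B'(t)>0$ and $B''(t)\ge 0$ for $t>0$, and let $\Gamma:\mathbb R\to[0,\infty)$ be such that $\Psi:=B^{-1}\circ\Gamma$ is of class $C^2$ on $\mathbb R$, where $B^{-1}:[0,\infty)\to[0,\infty)$ is the inverse of $B$ on $[0,\infty)$. Put $P(x)=B(|\nabla u(x)|^2)-\Gamma(u(x))$. Suppose that $P$ is a $P$-function with weight $\mu=\mu(|\nabla u|)$, that is: $\mu:[0,\infty)\to[0,\infty)$ with $\mu(t)>0$ for all $t>0$; $P$ is $C^2$ near each point where $\mu(|\nabla u|)>0$;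 and there is an operator $$L=-\sum_{i,j}a_{ij}(x)\,\partial_{x_ix_j}+\sum_i b_i(x)\,\partial_{x_i}+c(x),\qquad c\ge 0,$$ such that $\mu(|\nabla u|)\,LP\le 0$ on $\mathbb R^n$, and such that $L$ is uniformly elliptic on each set $\{|\nabla u|\ge\delta\}$, $\delta>0$, in the following sense: there is a constant $K=K(\delta)$ such that at every point $x$ of this set there is $\lambda(x)>0$ with $\lambda(x)|\xi|^2\le\sum_{i,j} a_{ij}(x)\xi_i\xi_j\le K\lambda(x)|\xi|^2$ for all $\xi\in\mathbb R^n$ and $|b(x)|\le K\lambda(x)$. If there is $x_0\in\mathbb R^n$ with $\Gamma(u(x_0))=0$, then $u$ is constant on $\mathbb R^n$. -/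

import Mathlib

/-- The Euclidean space `ℝⁿ`. -/
abbrev Rn (n : ℕ) : Type := EuclideanSpace ℝ (Fin n)

/-- The partial derivative `∂w/∂xᵢ`. -/
noncomputable def partialDeriv {n : ℕ} (i : Fin n) (w : Rn n → ℝ) (x : Rn n) : ℝ :=
  fderiv ℝ w x (EuclideanSpace.single i 1)

/-- The Hessian matrix `∇²w`. -/
noncomputable def hessian {n : ℕ} (w : Rn n → ℝ) (x : Rn n) : Matrix (Fin n) (Fin n) ℝ :=
  Matrix.of fun i j => partialDeriv i (partialDeriv j w) x

/-- `u` is an entire (classical) solution of `F(u, ∇u, ∇²u) = 0`. -/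
def IsEntireSolution {n : ℕ} (F : ℝ × Rn n × Matrix (Fin n) (Fin n) ℝ → ℝ)
    (u : Rn n → ℝ) : Prop :=
  ContDiff ℝ 2 u ∧ ∀ x, F (u x, gradient u x, hessian u x) = 0

/-- The standing assumption: `u ∈ C²(ℝⁿ) ∩ L^∞(ℝⁿ)`, `∇u ∈ C^α(ℝⁿ; ℝⁿ)` for some `α ∈ (0,1)`,
and `|∇u| ≤ C` on `ℝⁿ`. -/
structure StandingAssumption {n : ℕ} (u : Rn n → ℝ) : Prop where
  contDiff : ContDiff ℝ 2 u
  bounded : ∃ M : ℝ, ∀ x, |u x| ≤ M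
  holder : ∃ (α K : NNReal), 0 < α ∧ α < 1 ∧ HolderWith K α (gradient u)
  gradient_bounded : ∃ C : ℝ, 0 < C ∧ ∀ x, ‖gradient u x‖ ≤ C

/-- The coefficients of `L = - ∑ aᵢⱼ ∂ᵢⱼ + ∑ bᵢ ∂ᵢ + c`. -/
structure SecondOrderOperator (n : ℕ) where
  a : Rn n → Matrix (Fin n) (Fin n) ℝ
  b : Rn n → Rn n
  c : Rn n → ℝ

/-- `L w = - ∑ aᵢⱼ ∂ᵢⱼ w + ∑ bᵢ ∂ᵢ w + c w`. -/
noncomputable def SecondOrderOperator.apply {n : ℕ} (L : SecondOrderOperator n)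
    (w : Rn n → ℝ) (x : Rn n) : ℝ :=
  - (∑ i, ∑ j, L.a x i j * hessian w x i j) + (∑ i, L.b x i * partialDeriv i w x) + L.c x * w x

/-- `L` is uniformly elliptic on `S`: with a positive ellipticity `l(x)`, the ratio of the largest
to the smallest ellipticity and `|b|/l` are bounded on `S`. -/
def SecondOrderOperator.IsUniformlyEllipticOn {n : ℕ} (L : SecondOrderOperator n)
    (S : Set (Rn n)) : Prop :=
  ∃ K : ℝ, ∀ x ∈ S, ∃ l : ℝ, 0 < l ∧ ‖L.b x‖ ≤ K * l ∧
    ∀ ξ : Rn n, l * ‖ξ‖ ^ 2 ≤ ∑ i, ∑ j, L.a x i j * ξ i * ξ j ∧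
      ∑ i, ∑ j, L.a x i j * ξ i * ξ j ≤ K * l * ‖ξ‖ ^ 2

/-- `P = P(u, ∇u)` is a `P`-function along `u`, with weight `μ = μ(|∇u|) ≥ 0`: there is an elliptic
operator `L`, with `c ≥ 0`, such that `μ(|∇u|) L P(u, ∇u) ≤ 0` on `ℝⁿ`.
Ellipticity is uniform on each set where `|∇u|` is bounded away from `0`; nothing is asked of the
leading and first order coefficients at critical points of `u`. The function `x ↦ P(u(x), ∇u(x))`
is `C²` where the weight is positive, so that `L P` is classical there. -/
def IsPFunction {n : ℕ} (u : Rn n → ℝ) (P : ℝ → Rn n → ℝ) (μ : ℝ → ℝ) : Prop :=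
  (∀ t, 0 ≤ t → 0 ≤ μ t) ∧
  (∀ x, 0 < μ ‖gradient u x‖ → ContDiffAt ℝ 2 (fun y => P (u y) (gradient u y)) x) ∧
  ∃ L : SecondOrderOperator n,
    (∀ x, 0 ≤ L.c x) ∧
    (∀ δ : ℝ, 0 < δ → L.IsUniformlyEllipticOn {x | δ ≤ ‖gradient u x‖}) ∧
    ∀ x, μ ‖gradient u x‖ * L.apply (fun y => P (u y) (gradient u y)) x ≤ 0

/-! The core is the gradient bound `P ≤ 0`, that is `|∇u|² ≤ Ψ(u)` (`IsPFunction.le_zero`). If `S =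
sup P > 0`, then `|∇u|` is bounded below where `P > S/2`, so `L` is uniformly elliptic there. A
barrier argument (`quantitative_strong_maximum_principle`) shows that `P` almost equal to `S` at a
point forces `P > S/2` on a ball of any prescribed radius about it. But a bounded `u` has a point of
small gradient in every large ball. Since the estimate is quantitative, no limit of translates of
`u` or of `L` is needed.

Given the bound, `Ψ ≥ 0` has a minimum at its zero `u x₀`, so `Ψ(s) ≤ C²(s - u x₀)²` on the range of
`u`. Hence `|∇u| ≤ C|u - u x₀|`, and Gronwall along segments from `x₀` gives `u = u x₀`. -/

/-! ### Second derivatives at a local maximum -/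

lemma hessian_eq_fderiv_fderiv {n : ℕ} {w : Rn n → ℝ} {x : Rn n} (hw : ContDiffAt ℝ 2 w x)
    (i j : Fin n) :
    hessian w x i j = fderiv ℝ (fderiv ℝ w) x (EuclideanSpace.single i 1)
      (EuclideanSpace.single j 1) := by
  have hd : DifferentiableAt ℝ (fderiv ℝ w) x :=
    (hw.fderiv_right (m := 1) (by norm_num)).differentiableAt (by norm_num)
  have h := hd.hasFDerivAt.clm_apply
    (hasFDerivAt_const (EuclideanSpace.single j (1 : ℝ) : Rn n) x)
  change fderiv ℝ (fun y => fderiv ℝ w y (EuclideanSpace.single j 1)) x _ = _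
  rw [h.fderiv]
  simp

lemma hessian_add {n : ℕ} {v w : Rn n → ℝ} {x : Rn n} (hv : ContDiffAt ℝ 2 v x)
    (hw : ContDiffAt ℝ 2 w x) (i j : Fin n) :
    hessian (fun y => v y + w y) x i j = hessian v x i j + hessian w x i j := by
  have hdv : DifferentiableAt ℝ (fderiv ℝ v) x :=
    (hv.fderiv_right (m := 1) (by norm_num)).differentiableAt (by norm_num)
  have hdw : DifferentiableAt ℝ (fderiv ℝ w) x :=
    (hw.fderiv_right (m := 1) (by norm_num)).differentiableAt (by norm_num)
  have hev : ∀ᶠ y in nhds x, fderiv ℝ (fun y => v y + w y) y = fderiv ℝ v y + fderiv ℝ w y := by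
    filter_upwards [hv.eventually (by simp), hw.eventually (by simp)] with y h1 h2
    exact fderiv_fun_add (h1.differentiableAt (by norm_num)) (h2.differentiableAt (by norm_num))
  rw [hessian_eq_fderiv_fderiv (hv.add hw), hessian_eq_fderiv_fderiv hv,
    hessian_eq_fderiv_fderiv hw, Filter.EventuallyEq.fderiv_eq hev, fderiv_fun_add hdv hdw]
  simp

lemma fderiv_fderiv_apply_self_nonpos_of_isLocalMax {E : Type*} [NormedAddCommGroup E]
    [NormedSpace ℝ E] {w : E → ℝ} {x : E} (hw : ContDiffAt ℝ 2 w x) (hmax : IsLocalMax w x)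
    (ξ : E) : fderiv ℝ (fderiv ℝ w) x ξ ξ ≤ 0 := by
  by_contra! hpos
  have hl (t : ℝ) : HasDerivAt (fun t : ℝ => x + t • ξ) ξ t := by
    simpa using ((hasDerivAt_id t).smul_const ξ).const_add x
  have hl0 : Filter.Tendsto (fun t : ℝ => x + t • ξ) (nhds 0) (nhds x) := by
    simpa using (hl 0).continuousAt.tendsto
  set f : ℝ → ℝ := fun t => w (x + t • ξ) with hf
  have hfd : ∀ᶠ t in nhds (0 : ℝ), HasDerivAt f (fderiv ℝ w (x + t • ξ) ξ) t := by
    filter_upwards [hl0.eventually (hw.eventually (by simp))] with t ht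
    exact (ht.differentiableAt (by norm_num)).hasFDerivAt.comp_hasDerivAt t (hl t)
  have hfd' : deriv f =ᶠ[nhds 0] fun t => fderiv ℝ w (x + t • ξ) ξ :=
    hfd.mono fun t ht => ht.deriv
  have hd : DifferentiableAt ℝ (fderiv ℝ w) x :=
    (hw.fderiv_right (m := 1) (by norm_num)).differentiableAt (by norm_num)
  have hfdd : deriv (deriv f) 0 = fderiv ℝ (fderiv ℝ w) x ξ ξ := by
    rw [hfd'.deriv_eq]
    have hd' : HasFDerivAt (fderiv ℝ w) (fderiv ℝ (fderiv ℝ w) x) (x + (0 : ℝ) • ξ) := by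
      simpa using hd.hasFDerivAt
    exact ((ContinuousLinearMap.apply ℝ ℝ ξ).hasFDerivAt.comp_hasDerivAt (0 : ℝ)
      (hd'.comp_hasDerivAt (0 : ℝ) (hl 0))).deriv
  have hmaxf : IsLocalMax f 0 := by
    filter_upwards [hl0.eventually hmax] with t ht
    simpa [hf] using ht
  -- A positive second derivative would make the maximum a minimum too, so `f` would be locally
  -- constant.
  have hminf : IsLocalMin f 0 :=
    isLocalMin_of_deriv_deriv_pos (by rwa [hfdd]) hmaxf.deriv_eq_zero
      hfd.self_of_nhds.continuousAt
  have hconst : f =ᶠ[nhds 0] fun _ => f 0 := by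
    filter_upwards [hmaxf, hminf] with t h1 h2 using le_antisymm h1 h2
  have : deriv (deriv f) 0 = 0 := by
    rw [(hconst.deriv).deriv_eq]
    simp
  linarith

lemma Rn.eq_sum_single {n : ℕ} (ξ : Rn n) :
    ξ = ∑ i, ξ i • (EuclideanSpace.single i 1 : Rn n) := by
  ext k
  simp [Finset.sum_apply, Pi.single_apply]

-- Writing `-∇²w = MᵀM` turns the sum into minus the form of `a` summed over the rows of `M`; `a`
-- need not be symmetric.
open scoped MatrixOrder Matrix.Norms.L2Operator in
lemma sum_mul_hessian_nonpos_of_isLocalMax {n : ℕ} {w : Rn n → ℝ} {x : Rn n}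
    (hw : ContDiffAt ℝ 2 w x) (hmax : IsLocalMax w x) (a : Matrix (Fin n) (Fin n) ℝ)
    (ha : ∀ ξ : Rn n, 0 ≤ ∑ i, ∑ j, a i j * ξ i * ξ j) :
    ∑ i, ∑ j, a i j * hessian w x i j ≤ 0 := by
  have hpsd : (-hessian w x).PosSemidef := by
    refine Matrix.PosSemidef.of_dotProduct_mulVec_nonneg ?_ ?_
    · ext i j
      have hs := hw.isSymmSndFDerivAt (by simp)
      simp only [Matrix.conjTranspose_apply, Matrix.neg_apply, star_trivial, neg_inj]
      rw [hessian_eq_fderiv_fderiv hw, hessian_eq_fderiv_fderiv hw]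
      exact hs _ _
    · intro v
      have h := fderiv_fderiv_apply_self_nonpos_of_isLocalMax hw hmax (WithLp.toLp 2 v)
      rw [Rn.eq_sum_single (WithLp.toLp 2 v)] at h
      simp only [map_sum, map_smul, sum_apply, smul_apply,
        ← hessian_eq_fderiv_fderiv hw, smul_eq_mul] at h
      simp only [Matrix.neg_mulVec, dotProduct_neg, Left.nonneg_neg_iff]
      refine le_trans (le_of_eq ?_) h
      simp only [dotProduct, Matrix.mulVec, star_trivial, Finset.mul_sum, Pi.star_apply]
      rw [Finset.sum_comm]
      exact Finset.sum_congr rfl fun i _ => Finset.sum_congr rfl fun j _ => by ring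
  obtain ⟨M, hM⟩ := CStarAlgebra.nonneg_iff_eq_star_mul_self.1 (Matrix.nonneg_iff_posSemidef.2 hpsd)
  rw [Matrix.star_eq_conjTranspose] at hM
  have hM' (i j : Fin n) : hessian w x i j = -∑ k, M k i * M k j := by
    have := congrFun (congrFun hM i) j
    simp only [Matrix.neg_apply, Matrix.mul_apply, Matrix.conjTranspose_apply, star_trivial] at this
    linarith
  have key : ∑ i, ∑ j, a i j * hessian w x i j = -∑ k, ∑ i, ∑ j, a i j * M k i * M k j := by
    simp only [hM', mul_neg, Finset.sum_neg_distrib, Finset.mul_sum]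
    congr 1
    conv_rhs => rw [Finset.sum_comm]
    refine Finset.sum_congr rfl fun i _ => ?_
    rw [Finset.sum_comm]
    exact Finset.sum_congr rfl fun k _ => Finset.sum_congr rfl fun j _ => by ring
  rw [key, neg_nonpos]
  exact Finset.sum_nonneg fun k _ => ha (WithLp.toLp 2 (M k))

/-! ### The barrier and the strong maximum principle -/

/-- The Gaussian barrier. -/
noncomputable def gaussianBarrier {n : ℕ} (A β ρ : ℝ) (y z : Rn n) : ℝ :=
  A * (Real.exp (-β * ‖z - y‖ ^ 2) - Real.exp (-β * ρ ^ 2))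

lemma contDiff_gaussianBarrier {n : ℕ} (A β ρ : ℝ) (y : Rn n) :
    ContDiff ℝ 2 (gaussianBarrier A β ρ y) := by
  have : ContDiff ℝ 2 fun z : Rn n => ‖z - y‖ ^ 2 := (contDiff_id.sub contDiff_const).norm_sq ℝ
  unfold gaussianBarrier
  fun_prop

lemma hasFDerivAt_exp_neg_mul_norm_sub_sq {n : ℕ} (β : ℝ) (y z : Rn n) :
    HasFDerivAt (fun z : Rn n => Real.exp (-β * ‖z - y‖ ^ 2))
      ((-2 * β * Real.exp (-β * ‖z - y‖ ^ 2)) • innerSL ℝ (z - y)) z := by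
  have h := ((((hasFDerivAt_id z).sub_const y).norm_sq).const_mul (-β)).exp
  refine h.congr_fderiv ?_
  ext v
  simp
  ring

lemma partialDeriv_gaussianBarrier {n : ℕ} (A β ρ : ℝ) (y z : Rn n) (i : Fin n) :
    partialDeriv i (gaussianBarrier A β ρ y) z =
      A * Real.exp (-β * ‖z - y‖ ^ 2) * (-2 * β * (z i - y i)) := by
  have h := ((hasFDerivAt_exp_neg_mul_norm_sub_sq β y z).sub_const
    (Real.exp (-β * ρ ^ 2))).const_mul A
  unfold partialDeriv
  rw [show fderiv ℝ (gaussianBarrier A β ρ y) z = _ from h.fderiv]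
  simp [EuclideanSpace.inner_single_right]
  ring

lemma hessian_gaussianBarrier {n : ℕ} (A β ρ : ℝ) (y z : Rn n) (i j : Fin n) :
    hessian (gaussianBarrier A β ρ y) z i j = A * Real.exp (-β * ‖z - y‖ ^ 2) *
      (4 * β ^ 2 * (z i - y i) * (z j - y j) - 2 * β * if i = j then 1 else 0) := by
  have hc : HasFDerivAt (fun z : Rn n => z j - y j)
      (EuclideanSpace.proj j : Rn n →L[ℝ] ℝ) z :=
    ((EuclideanSpace.proj j : Rn n →L[ℝ] ℝ).hasFDerivAt).sub_const (y j)
  have h := ((hasFDerivAt_exp_neg_mul_norm_sub_sq β y z).const_mul A).mul (hc.const_mul (-2 * β))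
  change fderiv ℝ (partialDeriv j (gaussianBarrier A β ρ y)) z (EuclideanSpace.single i 1) = _
  rw [show partialDeriv j (gaussianBarrier A β ρ y) = _ from
    funext fun z => partialDeriv_gaussianBarrier A β ρ y z j]
  refine (congrArg (fun T : Rn n →L[ℝ] ℝ => T (EuclideanSpace.single i 1)) h.fderiv).trans ?_
  by_cases hij : i = j <;>
    simp [EuclideanSpace.inner_single_right, hij, eq_comm (a := j)] <;> ring

/-- A differential inequality at a touching point: if `w + φ` has a local maximum at
`x`, then `-a : ∇²w + b · ∇w ≥ a : ∇²φ - b · ∇φ` at `x`. -/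
lemma le_apply_of_isLocalMax_add {n : ℕ} (L : SecondOrderOperator n) {w φ : Rn n → ℝ} {x : Rn n}
    (hw : ContDiffAt ℝ 2 w x) (hφ : ContDiffAt ℝ 2 φ x)
    (hmax : IsLocalMax (fun y => w y + φ y) x)
    (ha : ∀ ξ : Rn n, 0 ≤ ∑ i, ∑ j, L.a x i j * ξ i * ξ j) :
    (∑ i, ∑ j, L.a x i j * hessian φ x i j) - (∑ i, L.b x i * partialDeriv i φ x)
      + L.c x * w x ≤ L.apply w x := by
  have h2 := sum_mul_hessian_nonpos_of_isLocalMax (hw.add hφ) hmax (L.a x) ha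
  have h1 (i : Fin n) : partialDeriv i w x = -partialDeriv i φ x := by
    have h := hmax.fderiv_eq_zero
    rw [fderiv_fun_add (hw.differentiableAt (by norm_num)) (hφ.differentiableAt (by norm_num))] at h
    have := congrArg (fun T : Rn n →L[ℝ] ℝ => T (EuclideanSpace.single i 1)) h
    simp only [add_apply, zero_apply] at this
    exact eq_neg_of_add_eq_zero_left this
  change ∑ i, ∑ j, L.a x i j * hessian (fun y => w y + φ y) x i j ≤ 0 at h2
  simp only [hessian_add hw hφ, mul_add, Finset.sum_add_distrib] at h2
  simp only [SecondOrderOperator.apply, h1, mul_neg, Finset.sum_neg_distrib]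
  linarith

/-- Away from the centre the `β²` term of the Hessian dominates the trace and drift terms, which are
of order `β`. All three scale with `l`, so the threshold for `β` does not involve `l`. -/
lemma gaussianBarrier_strict_subsolution {n : ℕ} (L : SecondOrderOperator n) {A β s R K l ρ : ℝ}
    {y z : Rn n} (hA : 0 < A) (hβ : 0 < β) (hs : 0 < s) (hl : 0 < l)
    (hsz : s ≤ ‖z - y‖) (hzR : ‖z - y‖ ≤ R) (hK : K * (n + R) < 2 * β * s ^ 2)
    (hb : ‖L.b z‖ ≤ K * l)
    (ha : ∀ ξ : Rn n, l * ‖ξ‖ ^ 2 ≤ ∑ i, ∑ j, L.a z i j * ξ i * ξ j ∧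
      ∑ i, ∑ j, L.a z i j * ξ i * ξ j ≤ K * l * ‖ξ‖ ^ 2) :
    0 < (∑ i, ∑ j, L.a z i j * hessian (gaussianBarrier A β ρ y) z i j)
      - ∑ i, L.b z i * partialDeriv i (gaussianBarrier A β ρ y) z := by
  set E := A * Real.exp (-β * ‖z - y‖ ^ 2) with hE
  have hEpos : 0 < E := by positivity
  set Q := ∑ i, ∑ j, L.a z i j * (z - y) i * (z - y) j with hQ
  set T := ∑ i, L.a z i i with hT
  set D := ∑ i, L.b z i * (z - y) i with hD
  have e1 : ∑ i, ∑ j, L.a z i j * hessian (gaussianBarrier A β ρ y) z i j =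
      E * (4 * β ^ 2 * Q - 2 * β * T) := by
    have hT' : T = ∑ i, ∑ j, L.a z i j * if i = j then 1 else 0 := by simp [hT]
    rw [hT', hQ]
    simp only [Finset.mul_sum, ← Finset.sum_sub_distrib]
    refine Finset.sum_congr rfl fun i _ => Finset.sum_congr rfl fun j _ => ?_
    rw [hessian_gaussianBarrier, PiLp.sub_apply, PiLp.sub_apply]
    ring
  have e2 : ∑ i, L.b z i * partialDeriv i (gaussianBarrier A β ρ y) z = E * (-2 * β * D) := by
    rw [hD]
    simp only [Finset.mul_sum]
    refine Finset.sum_congr rfl fun i _ => ?_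
    rw [partialDeriv_gaussianBarrier, PiLp.sub_apply]
    ring
  have hQl : l * s ^ 2 ≤ Q := le_trans (by gcongr) (ha (z - y)).1
  have hTl : T ≤ K * l * n := by
    have : T ≤ ∑ _i : Fin n, K * l := by
      refine Finset.sum_le_sum fun i _ => ?_
      simpa [Pi.single_apply] using (ha (EuclideanSpace.single i 1)).2
    simpa [mul_comm] using this
  have hDl : -D ≤ K * l * R := by
    have h1 : D = inner ℝ (z - y) (L.b z) := by simp [hD, PiLp.inner_apply]
    have h2 := abs_real_inner_le_norm (z - y) (L.b z)
    have h3 : ‖z - y‖ * ‖L.b z‖ ≤ R * (K * l) :=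
      mul_le_mul hzR hb (norm_nonneg _) ((norm_nonneg _).trans hzR)
    have h4 := neg_le_abs D
    rw [← h1] at h2
    linarith
  have hmain : 0 < 2 * β * Q - T + D := by
    have := mul_lt_mul_of_pos_right hK hl
    have := mul_le_mul_of_nonneg_left hQl (by positivity : 0 ≤ 2 * β)
    nlinarith
  rw [e1, e2]
  have : E * (4 * β ^ 2 * Q - 2 * β * T) - E * (-2 * β * D) =
      2 * β * E * (2 * β * Q - T + D) := by ring
  rw [this]
  positivity

/-- A quantitative strong maximum principle: where a subsolution `w ≤ S` of an operator that is
uniformly elliptic on `{w > m}` is very close to `S`, it is larger than `m` in a large ball. -/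
lemma quantitative_strong_maximum_principle {n : ℕ} (L : SecondOrderOperator n) {w : Rn n → ℝ}
    {S m R : ℝ} (hm : 0 ≤ m) (hmS : m < S) (hR : 0 < R) (hwS : ∀ x, w x ≤ S)
    (huc : UniformContinuous w) (hc : ∀ x, 0 ≤ L.c x)
    (hell : L.IsUniformlyEllipticOn {x | m < w x})
    (hC2 : ∀ x, m < w x → ContDiffAt ℝ 2 w x) (hL : ∀ x, m < w x → L.apply w x ≤ 0) :
    ∃ η, 0 < η ∧ ∀ x, S - η < w x → ∀ y, ‖x - y‖ ≤ R → m < w y := by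
  obtain ⟨K, hK⟩ := hell
  set ε := (S - m) / 2 with hε
  have hεpos : 0 < ε := by rw [hε]; linarith
  obtain ⟨s₀, hs₀, hs₀w⟩ := Metric.uniformContinuous_iff.1 huc ε hεpos
  set s := s₀ / 2 with hs
  have hspos : 0 < s := by positivity
  -- The barrier vanishes at radius `2R`, hence is at least some `η > 0` on the ball of radius `R`.
  set ρ := 2 * R with hρ
  obtain ⟨β, hβ0, hβ⟩ : ∃ β : ℝ, 0 < β ∧ K * (n + ρ) < 2 * β * s ^ 2 := by
    refine ⟨(|K * (n + ρ)| + 1) / (2 * s ^ 2), by positivity, ?_⟩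
    have : 2 * ((|K * (n + ρ)| + 1) / (2 * s ^ 2)) * s ^ 2 = |K * (n + ρ)| + 1 := by
      field_simp
    rw [this]
    linarith [le_abs_self (K * (n + ρ))]
  set η := ε * (Real.exp (-β * R ^ 2) - Real.exp (-β * ρ ^ 2)) with hη
  have hηpos : 0 < η := by
    refine mul_pos hεpos (sub_pos.2 (Real.exp_lt_exp.2 ?_))
    rw [hρ]
    nlinarith [mul_pos hβ0 (pow_pos hR 2)]
  have hηε : η ≤ ε := by
    have h1 : Real.exp (-β * R ^ 2) ≤ 1 := Real.exp_le_one_iff.2 (by nlinarith [sq_nonneg R])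
    have h2 := Real.exp_pos (-β * ρ ^ 2)
    rw [hη]
    nlinarith
  refine ⟨η, hηpos, fun x hx y hxy => ?_⟩
  by_contra! hy
  have hball : ∀ z, ‖z - y‖ ≤ s → w z < S - ε := by
    intro z hz
    have := hs₀w (a := z) (b := y) (by rw [dist_eq_norm]; linarith)
    rw [Real.dist_eq] at this
    have := le_abs_self (w z - w y)
    linarith
  set φ := gaussianBarrier ε β ρ y with hφ
  have hφle : ∀ z, φ z ≤ ε := by
    intro z
    have h1 : Real.exp (-β * ‖z - y‖ ^ 2) ≤ 1 :=
      Real.exp_le_one_iff.2 (by nlinarith [sq_nonneg ‖z - y‖])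
    have h2 := Real.exp_pos (-β * ρ ^ 2)
    simp only [hφ, gaussianBarrier]
    nlinarith
  have hφc : ContDiff ℝ 2 φ := contDiff_gaussianBarrier _ _ _ _
  have hxs : s < ‖x - y‖ := by
    by_contra! h
    linarith [hball x h]
  have hφx : η ≤ φ x := by
    simp only [hφ, gaussianBarrier, hη]
    have : Real.exp (-β * R ^ 2) ≤ Real.exp (-β * ‖x - y‖ ^ 2) := by
      refine Real.exp_le_exp.2 ?_
      have := pow_le_pow_left₀ (norm_nonneg _) hxy 2
      nlinarith
    gcongr
  -- The maximum exceeds `S` because of `x`. This excludes the outer sphere, where `φ = 0`, and the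
  -- inner ball, where `w < S - ε` and `φ ≤ ε`.
  obtain ⟨z, hz, hzmax⟩ := (isCompact_closedBall y ρ).exists_isMaxOn (f := fun z => w z + φ z)
    ((Metric.nonempty_closedBall).2 (by positivity))
    (huc.continuous.add hφc.continuous).continuousOn
  have hxz : w x + φ x ≤ w z + φ z := hzmax (by
    rw [Metric.mem_closedBall, dist_eq_norm]; linarith)
  have hzS : S < w z + φ z := by linarith
  have hzs : s < ‖z - y‖ := by
    by_contra! h
    linarith [hball z h, hφle z]
  have hzρ : ‖z - y‖ < ρ := by
    rw [Metric.mem_closedBall, dist_eq_norm] at hz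
    refine lt_of_le_of_ne hz fun h => ?_
    have : φ z = 0 := by simp [hφ, gaussianBarrier, h]
    linarith [hwS z]
  have hlm : IsLocalMax (fun z => w z + φ z) z :=
    hzmax.isLocalMax (Metric.closedBall_mem_nhds_of_mem (by
      rwa [Metric.mem_ball, dist_eq_norm]))
  have hzm : m < w z := by linarith [hφle z]
  obtain ⟨l, hl, hb, ha⟩ := hK z hzm
  have h1 := le_apply_of_isLocalMax_add L (hC2 z hzm) hφc.contDiffAt hlm
    fun ξ => le_trans (by positivity) (ha ξ).1
  have h2 := gaussianBarrier_strict_subsolution L (ρ := ρ) hεpos hβ0 hspos hl hzs.le hzρ.le hβ hb ha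
  have h3 : 0 ≤ L.c z * w z := mul_nonneg (hc z) (hm.trans hzm.le)
  linarith [hL z hzm]

/-! ### Points of small gradient -/

lemma norm_gradient_eq_norm_fderiv {n : ℕ} (u : Rn n → ℝ) (x : Rn n) :
    ‖gradient u x‖ = ‖fderiv ℝ u x‖ := by
  simp [gradient]

/-- A function bounded by `M` has a point in every large ball where its gradient is small. -/
lemma exists_norm_fderiv_lt_of_bounded {n : ℕ} {u : Rn n → ℝ} (hu : Differentiable ℝ u) {M : ℝ}
    (hM : ∀ x, |u x| ≤ M) {δ : ℝ} (hδ : 0 < δ) :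
    ∃ R, 0 < R ∧ ∀ x, ∃ z, ‖x - z‖ ≤ R ∧ ‖fderiv ℝ u z‖ < δ := by
  have hM0 : 0 ≤ M := (abs_nonneg _).trans (hM 0)
  set R := (6 * M + 1) / δ + 1 with hR
  have hRpos : 0 < R := by positivity
  have hRδ : 6 * M + 1 ≤ R * δ := by
    rw [hR, add_mul, div_mul_cancel₀ _ hδ.ne']; linarith
  -- `κR² > 2M` beats the oscillation of `u`, so `u + κ|· - x|²` has an interior minimum; there
  -- `|∇u| ≤ 2κR < δ`.
  set κ := (3 * M + 1 / 4) / R ^ 2 with hκ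
  have hκR : κ * R ^ 2 = 3 * M + 1 / 4 := by rw [hκ]; field_simp
  have hκ0 : 0 < κ := by positivity
  refine ⟨R, hRpos, fun x => ?_⟩
  have hcont : Continuous fun z => u z + κ * ‖z - x‖ ^ 2 := by
    have := hu.continuous
    fun_prop
  obtain ⟨z, hz, hzmin⟩ := (isCompact_closedBall x R).exists_isMinOn
    ((Metric.nonempty_closedBall).2 hRpos.le) hcont.continuousOn
  rw [Metric.mem_closedBall, dist_eq_norm] at hz
  refine ⟨z, by rwa [norm_sub_rev], ?_⟩
  have hxz : u z + κ * ‖z - x‖ ^ 2 ≤ u x := by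
    simpa using hzmin (Metric.mem_closedBall_self hRpos.le)
  have hlt : ‖z - x‖ < R := by
    refine lt_of_le_of_ne hz fun h => ?_
    rw [h, hκR] at hxz
    linarith [(abs_le.1 (hM x)).2, (abs_le.1 (hM z)).1]
  have hlm := hzmin.isLocalMin (Metric.closedBall_mem_nhds_of_mem (by
      rwa [Metric.mem_ball, dist_eq_norm]))
  have hd := (hu z).hasFDerivAt.add ((((hasFDerivAt_id z).sub_const x).norm_sq).const_mul κ)
  have h0 := hlm.hasFDerivAt_eq_zero hd
  rw [eq_neg_of_add_eq_zero_left h0, norm_neg]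
  refine lt_of_le_of_lt (b := κ * (2 * R)) ?_ ?_
  · refine ContinuousLinearMap.opNorm_le_bound _ (by positivity) fun v => ?_
    have h1 : |inner ℝ (z - x) v| ≤ R * ‖v‖ :=
      (abs_real_inner_le_norm _ _).trans (by gcongr)
    rw [inner_sub_left] at h1
    simp [abs_of_pos hκ0]
    nlinarith [mul_le_mul_of_nonneg_left h1 hκ0.le]
  · have : κ * (2 * R) * R = 6 * M + 1 / 2 := by linear_combination 2 * hκR
    nlinarith

/-! ### The gradient bound and the conclusion -/

lemma ContinuousOn.uniformContinuous_comp_of_mapsTo_Icc {X : Type*} [UniformSpace X] {f : ℝ → ℝ}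
    {g : X → ℝ} {a b : ℝ} (hf : ContinuousOn f (Set.Icc a b)) (hg : UniformContinuous g)
    (hab : ∀ x, g x ∈ Set.Icc a b) : UniformContinuous fun x => f (g x) := by
  have h := isCompact_Icc.uniformContinuousOn_of_continuous hf
  exact (uniformContinuousOn_univ.1 (h.comp hg.uniformContinuousOn fun x _ => hab x))

lemma strictMonoOn_of_deriv_pos_Ici {B : ℝ → ℝ} (hBcont : ContinuousOn B (Set.Ici 0))
    (hB' : ∀ t, 0 < t → 0 < deriv B t) : StrictMonoOn B (Set.Ici 0) :=
  strictMonoOn_of_deriv_pos (convex_Ici 0) hBcont fun t ht => hB' t (by simpa using ht)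

/-- A nonnegative `C²` function vanishes to second order at its zeros. -/
lemma exists_le_mul_sq_of_nonneg_of_eq_zero {Ψ : ℝ → ℝ} (hΨ0 : ∀ s, 0 ≤ Ψ s)
    (hΨ : ContDiff ℝ 2 Ψ) {s₀ M : ℝ} (hs₀ : s₀ ∈ Set.Icc (-M) M) (h0 : Ψ s₀ = 0) :
    ∃ C, 0 ≤ C ∧ ∀ s ∈ Set.Icc (-M) M, Ψ s ≤ C ^ 2 * (s - s₀) ^ 2 := by
  have hd : Differentiable ℝ Ψ := hΨ.differentiable (by norm_num)
  have hΨ1 : ContDiff ℝ 1 (deriv Ψ) := by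
    have : ContDiff ℝ (1 + 1) Ψ := by simpa [one_add_one_eq_two] using hΨ
    exact (contDiff_succ_iff_deriv.1 this).2.2
  have hd1 : Differentiable ℝ (deriv Ψ) := hΨ1.differentiable (by norm_num)
  have hd0 : deriv Ψ s₀ = 0 :=
    IsLocalMin.deriv_eq_zero (Filter.Eventually.of_forall fun s => by rw [h0]; exact hΨ0 s)
  obtain ⟨C₀, hC₀⟩ := (isCompact_Icc (a := -M) (b := M)).exists_bound_of_continuousOn
    (hΨ1.continuous_deriv (by norm_num)).continuousOn
  have hC₀0 : 0 ≤ C₀ := (norm_nonneg _).trans (hC₀ s₀ hs₀)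
  have h1 : ∀ s ∈ Set.Icc (-M) M, |deriv Ψ s| ≤ C₀ * |s - s₀| := by
    intro s hs
    simpa [hd0] using (convex_Icc (-M) M).norm_image_sub_le_of_norm_deriv_le
      (fun t _ => hd1 t) hC₀ hs₀ hs
  refine ⟨√C₀, Real.sqrt_nonneg _, fun s hs => ?_⟩
  rw [Real.sq_sqrt hC₀0]
  have hsub : Set.uIcc s₀ s ⊆ Set.Icc (-M) M := Set.uIcc_subset_Icc hs₀ hs
  have h2 := (convex_uIcc s₀ s).norm_image_sub_le_of_norm_deriv_le (f := Ψ)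
    (C := C₀ * |s - s₀|) (fun t _ => hd t)
    (fun t ht => (h1 t (hsub ht)).trans (mul_le_mul_of_nonneg_left
      (Set.abs_sub_left_of_mem_uIcc ht) hC₀0)) Set.left_mem_uIcc Set.right_mem_uIcc
  rw [h0, sub_zero, Real.norm_eq_abs, Real.norm_eq_abs, mul_assoc, abs_mul_abs_self] at h2
  nlinarith [le_abs_self (Ψ s)]

lemma eq_of_norm_fderiv_le_mul_abs_sub {E : Type*} [NormedAddCommGroup E] [NormedSpace ℝ E]
    {u : E → ℝ} (hu : Differentiable ℝ u) {C : ℝ} {x₀ : E}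
    (h : ∀ x, ‖fderiv ℝ u x‖ ≤ C * |u x - u x₀|) (x : E) : u x = u x₀ := by
  set g : ℝ → ℝ := fun t => u (x₀ + t • (x - x₀)) - u x₀ with hg
  have hgd (t : ℝ) : HasDerivAt g (fderiv ℝ u (x₀ + t • (x - x₀)) (x - x₀)) t := by
    have hl : HasDerivAt (fun t : ℝ => x₀ + t • (x - x₀)) (x - x₀) t := by
      simpa using ((hasDerivAt_id t).smul_const (x - x₀)).const_add x₀
    exact ((hu _).hasFDerivAt.comp_hasDerivAt t hl).sub_const _
  have := eq_zero_of_abs_deriv_le_mul_abs_self_of_eq_zero_right (K := C * ‖x - x₀‖)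
    (a := 0) (b := 1) (fun t _ => (hgd t).continuousAt.continuousWithinAt)
    (fun t _ => (hgd t).hasDerivWithinAt) (by simp [hg]) (fun t _ => by
      refine (ContinuousLinearMap.le_opNorm _ _).trans ?_
      have := mul_le_mul_of_nonneg_right (h (x₀ + t • (x - x₀))) (norm_nonneg (x - x₀))
      rw [Real.norm_eq_abs]
      linarith) 1 (by simp)
  simpa [hg, sub_eq_zero] using this

lemma IsPFunction.le_zero {n : ℕ} {u : Rn n → ℝ} (hu : StandingAssumption u) {B Γ μ Ψ : ℝ → ℝ}
    (hBcont : ContinuousOn B (Set.Ici 0)) (hBmono : StrictMonoOn B (Set.Ici 0)) (hB0 : B 0 = 0)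
    (hΓ : ∀ s, 0 ≤ Γ s) (hΨ0 : ∀ s, 0 ≤ Ψ s) (hΨ : ∀ s, B (Ψ s) = Γ s) (hΨc : Continuous Ψ)
    (hμ : ∀ t, 0 < t → 0 < μ t) (hP : IsPFunction u (fun s p => B (‖p‖ ^ 2) - Γ s) μ) (x : Rn n) :
    B (‖gradient u x‖ ^ 2) - Γ (u x) ≤ 0 := by
  obtain ⟨-, hC2, L, hc, hell, hL⟩ := hP
  obtain ⟨M, hM⟩ := hu.bounded
  obtain ⟨α, K, hα, -, hH⟩ := hu.holder
  obtain ⟨C, hC, hCu⟩ := hu.gradient_bounded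
  have hdiff : Differentiable ℝ u := hu.contDiff.differentiable (by norm_num)
  set w : Rn n → ℝ := fun y => B (‖gradient u y‖ ^ 2) - Γ (u y) with hw
  have hgm (y : Rn n) : ‖gradient u y‖ ^ 2 ∈ Set.Icc 0 (C ^ 2) :=
    ⟨by positivity, pow_le_pow_left₀ (norm_nonneg _) (hCu y) 2⟩
  have hum (y : Rn n) : u y ∈ Set.Icc (-M) M := abs_le.1 (hM y)
  have huu : UniformContinuous u := by
    refine (lipschitzWith_of_nnnorm_fderiv_le (C := C.toNNReal) hdiff fun y => ?_).uniformContinuous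
    rw [← NNReal.coe_le_coe, coe_nnnorm, Real.coe_toNNReal C hC.le, ← norm_gradient_eq_norm_fderiv]
    exact hCu y
  have hgu : UniformContinuous fun y => ‖gradient u y‖ ^ 2 :=
    ContinuousOn.uniformContinuous_comp_of_mapsTo_Icc (f := fun t => t ^ 2) (a := 0) (b := C)
      (by fun_prop) (uniformContinuous_norm.comp (hH.uniformContinuous hα))
      fun y => ⟨norm_nonneg _, hCu y⟩
  have hBg : UniformContinuous fun y => B (‖gradient u y‖ ^ 2) :=
    (hBcont.mono Set.Icc_subset_Ici_self).uniformContinuous_comp_of_mapsTo_Icc hgu hgm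
  have hΓu : UniformContinuous fun y => Γ (u y) := by
    have : Continuous Γ := by
      rw [show Γ = B ∘ Ψ from funext fun s => (hΨ s).symm]
      exact hBcont.comp_continuous hΨc hΨ0
    exact this.continuousOn.uniformContinuous_comp_of_mapsTo_Icc huu hum
  have hwuc : UniformContinuous w := hBg.sub hΓu
  have hbdd : BddAbove (Set.range w) := by
    refine ⟨B (C ^ 2), ?_⟩
    rintro _ ⟨y, rfl⟩
    have := hBmono.monotoneOn (hgm y).1 (show (0 : ℝ) ≤ C ^ 2 by positivity) (hgm y).2
    simp only [hw]
    linarith [hΓ (u y)]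
  by_contra! hpos
  set S := ⨆ y, w y with hS
  have hwS (y : Rn n) : w y ≤ S := le_ciSup hbdd y
  have hSpos : 0 < S := hpos.trans_le (hwS x)
  -- As `Γ ≥ 0`, `w > S/2` gives `B(|∇u|²) > S/2`; continuity of `B` at `0` with `B 0 = 0` keeps
  -- `|∇u|` away from `0`.
  obtain ⟨δ, hδ, hδB⟩ : ∃ δ, 0 < δ ∧ ∀ y, S / 2 < w y → δ ≤ ‖gradient u y‖ := by
    have hcw := Metric.continuousWithinAt_iff.1 (hBcont 0 Set.self_mem_Ici) (S / 2) (by positivity)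
    obtain ⟨d, hd, hdB⟩ := hcw
    refine ⟨√d, Real.sqrt_pos.2 hd, fun y hy => ?_⟩
    by_contra! hlt
    have hlt' : ‖gradient u y‖ ^ 2 < d := by
      rwa [Real.lt_sqrt (norm_nonneg _)] at hlt
    have := hdB (x := ‖gradient u y‖ ^ 2) (hgm y).1 (by
      rwa [Real.dist_eq, sub_zero, abs_of_nonneg (hgm y).1])
    rw [Real.dist_eq, hB0, sub_zero] at this
    have := le_abs_self (B (‖gradient u y‖ ^ 2))
    simp only [hw] at hy
    linarith [hΓ (u y)]
  have hμw (y : Rn n) (hy : S / 2 < w y) : 0 < μ ‖gradient u y‖ :=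
    hμ _ (hδ.trans_le (hδB y hy))
  obtain ⟨R, hR, hRz⟩ := exists_norm_fderiv_lt_of_bounded hdiff hM hδ
  obtain ⟨η, hη, hmax⟩ := quantitative_strong_maximum_principle L (m := S / 2) (by positivity)
    (by linarith) hR hwS hwuc hc
    (by
      obtain ⟨K, hK⟩ := hell δ hδ
      exact ⟨K, fun y hy => hK y (hδB y hy)⟩)
    (fun y hy => hC2 y (hμw y hy))
    (fun y hy => nonpos_of_mul_nonpos_right (hL y) (hμw y hy))
  obtain ⟨y, hy⟩ := exists_lt_of_lt_ciSup (show S - η < ⨆ y, w y by linarith)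
  obtain ⟨z, hz, hzδ⟩ := hRz y
  have := hδB z (hmax y hy z hz)
  rw [norm_gradient_eq_norm_fderiv] at this
  linarith

theorem mainTheorem5 (n : ℕ)
    (F : ℝ × Rn n × Matrix (Fin n) (Fin n) ℝ → ℝ) (hF : Continuous F)
    (u : Rn n → ℝ) (hsol : IsEntireSolution F u) (hu : StandingAssumption u)
    (B Γ μ : ℝ → ℝ)
    (hBcont : ContinuousOn B (Set.Ici 0)) (hBdiff : ContDiffOn ℝ 2 B (Set.Ioi 0))
    (hB' : ∀ t, 0 < t → 0 < deriv B t) (hB'' : ∀ t, 0 < t → 0 ≤ deriv (deriv B) t)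
    (hB0 : B 0 = 0) (hΓ : ∀ s, 0 ≤ Γ s)
    -- `Ψ = B⁻¹ ∘ Γ` is of class `C²`
    (Ψ : ℝ → ℝ) (hΨ0 : ∀ s, 0 ≤ Ψ s) (hΨ : ∀ s, B (Ψ s) = Γ s) (hΨdiff : ContDiff ℝ 2 Ψ)
    (hμ : ∀ t, 0 < t → 0 < μ t)
    (hP : IsPFunction u (fun s p => B (‖p‖ ^ 2) - Γ s) μ)
    (x₀ : Rn n) (hx₀ : Γ (u x₀) = 0) :
    ∃ k : ℝ, ∀ x, u x = k := by
  have hmono := strictMonoOn_of_deriv_pos_Ici hBcont hB'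
  obtain ⟨M, hM⟩ := hu.bounded
  have hΨx₀ : Ψ (u x₀) = 0 :=
    hmono.injOn (hΨ0 _) Set.self_mem_Ici (by rw [hΨ, hx₀, hB0])
  obtain ⟨C, hC, hCΨ⟩ := exists_le_mul_sq_of_nonneg_of_eq_zero hΨ0 hΨdiff (abs_le.1 (hM x₀)) hΨx₀
  refine ⟨u x₀, eq_of_norm_fderiv_le_mul_abs_sub (C := C)
    (hu.contDiff.differentiable (by norm_num)) fun x => ?_⟩
  have h1 := hP.le_zero hu hBcont hmono hB0 hΓ hΨ0 hΨ hΨdiff.continuous hμ x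
  rw [← hΨ, sub_nonpos, hmono.le_iff_le (show (0 : ℝ) ≤ _ by positivity) (hΨ0 _)] at h1
  have h2 := h1.trans (hCΨ _ (abs_le.1 (hM x)))
  rw [← norm_gradient_eq_norm_fderiv]
  refine abs_le_of_sq_le_sq' ?_ (by positivity) |>.2
  rwa [mul_pow, sq_abs]
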